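/- Let $\mathbb{S}$ be the sphere of purely imaginary unit quaternions and, for $I\in\mathbb{S}$, let $\mathbb{C}_I=\{x+Iy : x,y\in\mathbb{R}\}$ with area measure $m_I$. A real differentiable function $f:\mathbb{H}\to\mathbb{H}$ is called entire (left) slice regular if $\frac12\left(\frac{\partial}{\partial x}+I\frac{\partial}{\partial y}\right)f(x+Iy)=0$ for all $I\in\mathbb{S}$ and $x,y\in\mathbb{R}$. For $0<p<\infty$, $\alpha>0$, $I\in\mathbb{S}$ and $f:\mathbb{H}\to\mathbb{H}$ continuous put $$\|f\|_{p,\alpha,I}=\left(\frac{\alpha p}{2\pi}\int_{\mathbb{C}_I}|f(q)|^p\left(e^{-\alpha|q|^2/2}\right)^p\,dm_I(q)\right)^{1/p}\in[0,\infty].$$ The Fock space of the second kind $\mathcal{F}^{\alpha,p}_{Slice}(\mathbb{H})$ consists of all entire slice regular functions $f$ such that $\|f\|_{p,\alpha,I}<\infty$ for some $I\in\mathbb{S}$. **Theorem.** Let $0<p<\infty$, $0<\alpha<\infty$ and $f\in\mathcal{F}^{\alpha,p}_{Slice}(\mathbb{H})$. Then there exists a sequence $(P_n)_{n\in\mathbb{N}}$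 of quaternionic polynomials with coefficients on the right, $P_n(q)=\sum_{k=0}^{d_n}q^k a_{n,k}$ with $a_{n,k}\in\mathbb{H}$, such that for every $I\in\mathbb{S}$ $$\|P_n-f\|_{p,\alpha,I}\to 0\quad\text{as } n\to\infty.$$ -/

import Mathlib

open MeasureTheory Filter
open scoped Quaternion ENNReal Topology

namespace SliceFock

/-- The sphere `𝕊` of purely imaginary unit quaternions. -/
def imagUnits : Set ℍ[ℝ] :=
  {q | q.re = 0 ∧ q.imI ^ 2 + q.imJ ^ 2 + q.imK ^ 2 = 1}

/-- The parametrization `x + iy ↦ x + Iy` of the slice `ℂ_I` by the complex plane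
(an isometry onto `ℂ_I` for `I ∈ 𝕊`). -/
noncomputable def slicePt (I : ℍ[ℝ]) (z : ℂ) : ℍ[ℝ] :=
  (z.re : ℍ[ℝ]) + I * (z.im : ℍ[ℝ])

/-- The operator `½ (∂/∂x + I ∂/∂y)` applied to the restriction of `f` to `ℂ_I`,
at the point `x + Iy`. -/
noncomputable def sliceDbar (I : ℍ[ℝ]) (f : ℍ[ℝ] → ℍ[ℝ]) (x y : ℝ) : ℍ[ℝ] :=
  (1 / 2 : ℝ) •
    (deriv (fun s : ℝ => f (slicePt I ⟨s, y⟩)) x +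
      I * deriv (fun t : ℝ => f (slicePt I ⟨x, t⟩)) y)

/-- Entire (left) slice regular functions, `𝒮ℛ(ℍ)`. -/
structure IsEntireSliceRegular (f : ℍ[ℝ] → ℍ[ℝ]) : Prop where
  differentiable : Differentiable ℝ f
  dbar_eq_zero : ∀ I ∈ imagUnits, ∀ x y : ℝ, sliceDbar I f x y = 0

/-- The slice (quasi-)norm
`‖f‖_{p,α,I} = ((αp/2π) ∫_{ℂ_I} |f(q)|^p (e^{-α|q|²/2})^p dm_I(q))^{1/p}`, with values in `[0,∞]`.
The area measure on `ℂ_I` is Lebesgue measure on `ℂ` transported by `slicePt I`. -/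
noncomputable def sliceNorm (p α : ℝ) (I : ℍ[ℝ]) (f : ℍ[ℝ] → ℍ[ℝ]) : ℝ≥0∞ :=
  (ENNReal.ofReal (α * p / (2 * Real.pi)) *
    ∫⁻ z : ℂ, ENNReal.ofReal
      (‖f (slicePt I z)‖ ^ p * (Real.exp (-α * ‖slicePt I z‖ ^ 2 / 2)) ^ p)) ^ (1 / p)

/-- The space `𝓕^p_{α,I}(ℍ)` of entire slice regular functions with `‖f‖_{p,α,I} < ∞`. -/
def fockOnSlice (p α : ℝ) (I : ℍ[ℝ]) : Set (ℍ[ℝ] → ℍ[ℝ]) :=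
  {f | IsEntireSliceRegular f ∧ sliceNorm p α I f < ∞}

/-- The Fock space of the second kind `𝓕^{α,p}_{Slice}(ℍ)`: entire slice regular functions that
belong to `𝓕^p_{α,I}(ℍ)` for some `I ∈ 𝕊`. -/
def fockSecondKind (α p : ℝ) : Set (ℍ[ℝ] → ℍ[ℝ]) :=
  {f | IsEntireSliceRegular f ∧ ∃ I ∈ imagUnits, f ∈ fockOnSlice p α I}

/-- The value at `q` of the quaternionic polynomial `∑ q^k a_k`, with the coefficients written on
the right (`Polynomial.eval` would put them on the left). -/
noncomputable def rightEval (P : Polynomial ℍ[ℝ]) (q : ℍ[ℝ]) : ℍ[ℝ] :=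
  P.sum fun k a => q ^ k * a

end SliceFock

/-!
On a single slice `ℂ_I ≅ ℂ` the norm `‖·‖_{p,α,I}` is the `L^p` quasi-norm of a Gaussian measure,
and `f` restricts to an entire function `F` with values in `ℍ`, seen as a complex vector space
through left multiplication by `ℂ_I`. The dilations `F (r ·)` tend to `F` in `L^p` as `r → 1⁻`,
because bounded continuous functions are dense. For fixed `r < 1`, a submean inequality (valid for
all `p > 0`) bounds `|F z|` by `C exp (β |z|² / 2)` for every `β > α`, so by Cauchy's estimates the
Taylor polynomials of `F (r ·)` converge to it in `L^p`.

One slice controls all others: a function `g` given by a series `∑ q^k c_k` satisfies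
the representation formula `g (x + Jy) = ½ (1 - JI) g (x + Iy) + ½ (1 + JI) g (x - Iy)`, hence its
norms on any two slices are comparable.
-/

namespace SliceFock

section Submean

variable {E : Type*} [NormedAddCommGroup E]

lemma exists_norm_le_two_rpow_mul_on_half_ball {X : Type*} [PseudoMetricSpace X] [ProperSpace X]
    {F : X → E} {c : X} {R s : ℝ} (hR : 0 < R) (hs : 0 < s)
    (hF : ContinuousOn F (Metric.closedBall c R)) (hc : F c ≠ 0) :
    ∃ z₀ d, 0 < d ∧ dist z₀ c + d ≤ R ∧ R ^ s * ‖F c‖ ≤ d ^ s * ‖F z₀‖ ∧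
      ∀ w ∈ Metric.ball z₀ (d / 2), ‖F w‖ ≤ 2 ^ s * ‖F z₀‖ := by
  -- `z₀` maximizes `(R - dist w c) ^ s * ‖F w‖`, a weight vanishing on the boundary.
  have hcont : ContinuousOn (fun w => (R - dist w c) ^ s * ‖F w‖) (Metric.closedBall c R) :=
    ContinuousOn.mul (Continuous.continuousOn <|
      Continuous.rpow_const (by fun_prop) fun _ => Or.inr hs.le) hF.norm
  have hcR : c ∈ Metric.closedBall c R := Metric.mem_closedBall_self hR.le
  obtain ⟨z₀, hz₀, hmax⟩ := (isCompact_closedBall c R).exists_isMaxOn ⟨c, hcR⟩ hcont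
  have hcle : R ^ s * ‖F c‖ ≤ (R - dist z₀ c) ^ s * ‖F z₀‖ := by simpa using hmax hcR
  have hd : 0 < R - dist z₀ c := by
    refine (sub_nonneg.2 (Metric.mem_closedBall.1 hz₀)).lt_of_ne' fun h => ?_
    rw [h, Real.zero_rpow hs.ne', zero_mul] at hcle
    exact hcle.not_gt (by positivity)
  refine ⟨z₀, R - dist z₀ c, hd, by linarith, hcle, fun w hw => ?_⟩
  set d := R - dist z₀ c
  have hdist : d / 2 ≤ R - dist w c := by
    linarith [Metric.mem_ball.1 hw, dist_triangle w z₀ c]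
  have hwR : w ∈ Metric.closedBall c R := Metric.mem_closedBall.2 (by linarith)
  refine le_of_mul_le_mul_left ?_ (show 0 < (d / 2) ^ s by positivity)
  calc (d / 2) ^ s * ‖F w‖ ≤ (R - dist w c) ^ s * ‖F w‖ := by gcongr
    _ ≤ d ^ s * ‖F z₀‖ := hmax hwR
    _ = (d / 2) ^ s * (2 ^ s * ‖F z₀‖) := by
      rw [← mul_assoc, ← Real.mul_rpow (by positivity) zero_le_two, div_mul_cancel₀ _ two_ne_zero]

lemma ofReal_rpow_mul_norm_le_eLpNorm_ball {p : ℝ} (hp : 0 < p) {F : ℂ → E} {z : ℂ} {σ : ℝ}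
    (hσ : 0 < σ) (hF : ∀ w ∈ Metric.ball z σ, ‖F z‖ / 2 ≤ ‖F w‖) :
    ENNReal.ofReal (σ ^ (2 / p) * ‖F z‖) ≤
      2 * eLpNorm F (ENNReal.ofReal p) (volume.restrict (Metric.ball z σ)) := by
  have hpi : (1 : ℝ≥0∞) ≤ NNReal.pi := by
    rw [ENNReal.one_le_coe_iff, ← NNReal.coe_le_coe]
    change 1 ≤ Real.pi
    linarith [Real.pi_gt_three]
  have hvol : ENNReal.ofReal (σ ^ (2 / p)) ≤ volume (Metric.ball z σ) ^ (1 / p) := by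
    rw [Complex.volume_ball, ENNReal.mul_rpow_of_nonneg _ _ (by positivity)]
    calc ENNReal.ofReal (σ ^ (2 / p)) = (ENNReal.ofReal σ ^ 2) ^ (1 / p) := by
          rw [← ENNReal.rpow_natCast_mul, ENNReal.ofReal_rpow_of_pos hσ]
          congr 2; push_cast; ring
      _ ≤ _ := le_mul_of_one_le_right' (ENNReal.one_le_rpow hpi (by positivity))
  have hlow := le_eLpNorm_of_bddBelow (μ := volume.restrict (Metric.ball z σ))
    (ENNReal.ofReal_pos.2 hp).ne' ENNReal.ofReal_ne_top (‖F z‖₊ / 2) measurableSet_ball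
    (Eventually.of_forall fun w hw => hF w hw)
  rw [ENNReal.toReal_ofReal hp.le, Measure.restrict_apply_self] at hlow
  have htwo : (2 : ℝ≥0∞) * ((‖F z‖₊ / 2 : NNReal) : ℝ≥0∞) = ‖F z‖ₑ := by
    rw [← ENNReal.coe_ofNat, ← ENNReal.coe_mul, mul_div_cancel₀ _ two_ne_zero]
    rfl
  calc ENNReal.ofReal (σ ^ (2 / p) * ‖F z‖)
      = ENNReal.ofReal (σ ^ (2 / p)) * ‖F z‖ₑ := by
        rw [ENNReal.ofReal_mul (by positivity), ofReal_norm]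
    _ ≤ volume (Metric.ball z σ) ^ (1 / p) * ‖F z‖ₑ := by gcongr
    _ = 2 * ((‖F z‖₊ / 2 : NNReal) • volume (Metric.ball z σ) ^ (1 / p)) := by
        rw [ENNReal.smul_def, smul_eq_mul, ← mul_assoc, htwo, mul_comm]
    _ ≤ _ := by gcongr

variable [NormedSpace ℂ E]

lemma half_norm_le_norm_of_norm_le_mul {V : Type*} [NormedAddCommGroup V] [NormedSpace ℂ V]
    {F : V → E} {z₀ w : V} {ρ K : ℝ} (hK : 0 ≤ K)
    (hF : DifferentiableOn ℂ F (Metric.ball z₀ ρ))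
    (hbound : ∀ w ∈ Metric.ball z₀ ρ, ‖F w‖ ≤ K * ‖F z₀‖)
    (hw : w ∈ Metric.ball z₀ (ρ / (2 * (K + 1)))) : ‖F z₀‖ / 2 ≤ ‖F w‖ := by
  have hρ : 0 < ρ := by
    have : 0 < ρ / (2 * (K + 1)) := Metric.pos_of_mem_ball hw
    exact (div_pos_iff_of_pos_right (by positivity)).1 this
  have hsub : Metric.ball z₀ (ρ / (2 * (K + 1))) ⊆ Metric.ball z₀ ρ :=
    Metric.ball_subset_ball (div_le_self hρ.le (by linarith))
  have hmaps : Set.MapsTo F (Metric.ball z₀ ρ)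
      (Metric.closedBall (F z₀) ((K + 1) * ‖F z₀‖)) := fun u hu => by
    rw [mem_closedBall_iff_norm]
    linarith [hbound u hu, norm_sub_le (F u) (F z₀)]
  have hdist : dist (F w) (F z₀) ≤ ‖F z₀‖ / 2 := by
    calc dist (F w) (F z₀) ≤ (K + 1) * ‖F z₀‖ / ρ * dist w z₀ :=
          Complex.dist_le_div_mul_dist_of_mapsTo_ball hF hmaps (hsub hw)
      _ ≤ (K + 1) * ‖F z₀‖ / ρ * (ρ / (2 * (K + 1))) := by
          gcongr
          exact (Metric.mem_ball.1 hw).le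
      _ = ‖F z₀‖ / 2 := by field_simp
  rw [dist_comm, dist_eq_norm] at hdist
  linarith [norm_sub_norm_le (F z₀) (F w)]

lemma exists_ofReal_rpow_mul_norm_le_mul_eLpNorm_ball {p : ℝ} (hp : 0 < p) :
    ∃ C : ℝ≥0∞, C ≠ ∞ ∧ ∀ (F : ℂ → E) (c : ℂ) (R : ℝ), 0 < R →
      DiffContOnCl ℂ F (Metric.ball c R) → ENNReal.ofReal (R ^ (2 / p) * ‖F c‖) ≤
        C * eLpNorm F (ENNReal.ofReal p) (volume.restrict (Metric.ball c R)) := by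
  set K : ℝ := 2 ^ (2 / p)
  set A : ℝ := 4 * (K + 1)
  have hA : 0 < A := by positivity
  refine ⟨ENNReal.ofReal (A ^ (2 / p)) * 2, by finiteness, fun F c R hR hF => ?_⟩
  rcases eq_or_ne (F c) 0 with hc | hc
  · simp [hc]
  obtain ⟨z₀, d, hd, hdR, hcd, hbound⟩ := exists_norm_le_two_rpow_mul_on_half_ball hR
    (div_pos two_pos hp) hF.continuousOn_ball hc
  have hsub : ∀ ρ ≤ d, Metric.ball z₀ ρ ⊆ Metric.ball c R := fun ρ hρ =>
    Metric.ball_subset_ball' (by linarith)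
  have hlow : ∀ w ∈ Metric.ball z₀ (d / A), ‖F z₀‖ / 2 ≤ ‖F w‖ := fun w hw =>
    half_norm_le_norm_of_norm_le_mul (by positivity)
      (hF.differentiableOn.mono (hsub _ (by linarith))) hbound
      (by rwa [show d / 2 / (2 * (K + 1)) = d / A by simp only [A]; field_simp; norm_num])
  calc ENNReal.ofReal (R ^ (2 / p) * ‖F c‖)
      ≤ ENNReal.ofReal (A ^ (2 / p) * ((d / A) ^ (2 / p) * ‖F z₀‖)) := by
        refine ENNReal.ofReal_le_ofReal (hcd.trans_eq ?_)
        rw [← mul_assoc, ← Real.mul_rpow hA.le (by positivity), mul_div_cancel₀ _ hA.ne']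
    _ ≤ ENNReal.ofReal (A ^ (2 / p)) *
          (2 * eLpNorm F (ENNReal.ofReal p) (volume.restrict (Metric.ball z₀ (d / A)))) := by
        rw [ENNReal.ofReal_mul (by positivity)]
        gcongr
        exact ofReal_rpow_mul_norm_le_eLpNorm_ball hp (by positivity) hlow
    _ ≤ _ := by
        rw [mul_assoc]
        gcongr
        exact hsub _ (div_le_self hd.le (by simp only [A]; linarith [show 0 < K by positivity]))

end Submean

section Convergence

variable {X E ι : Type*} [MeasurableSpace X] {μ : Measure X} [NormedAddCommGroup E]
  {l : Filter ι} [l.IsCountablyGenerated] {p : ℝ≥0∞}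

lemma tendsto_eLpNorm_zero_of_dominated (hp : p ≠ ∞) {G : ι → X → E} {b : X → ℝ}
    (hG : ∀ᶠ i in l, AEStronglyMeasurable (G i) μ) (hb : MemLp b p μ)
    (hle : ∀ᶠ i in l, ∀ᵐ x ∂μ, ‖G i x‖ ≤ b x)
    (hlim : ∀ᵐ x ∂μ, Tendsto (fun i => G i x) l (𝓝 0)) :
    Tendsto (fun i => eLpNorm (G i) p μ) l (𝓝 0) := by
  rcases eq_or_ne p 0 with rfl | hp0
  · simpa using tendsto_const_nhds
  have hp' := ENNReal.toReal_pos hp0 hp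
  have hint : Tendsto (fun i => ∫⁻ x, ‖G i x‖ₑ ^ p.toReal ∂μ) l (𝓝 (∫⁻ _, 0 ∂μ)) := by
    refine tendsto_lintegral_filter_of_dominated_convergence' (fun x => ‖b x‖ₑ ^ p.toReal)
      (hG.mono fun i hi => hi.enorm.pow_const _) ?_
      (lintegral_rpow_enorm_lt_top_of_eLpNorm_lt_top hp0 hp hb.2).ne ?_
    · filter_upwards [hle] with i hi
      filter_upwards [hi] with x hx
      gcongr
      exact enorm_le_iff_norm_le.2 (hx.trans (le_abs_self _))
    · filter_upwards [hlim] with x hx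
      simpa [ENNReal.zero_rpow_of_pos hp'] using hx.enorm.ennrpow_const p.toReal
  rw [lintegral_zero] at hint
  simp_rw [eLpNorm_eq_lintegral_rpow_enorm_toReal hp0 hp]
  simpa [ENNReal.zero_rpow_of_pos (inv_pos.2 hp')] using hint.ennrpow_const (1 / p.toReal)

lemma aestronglyMeasurable_comp_of_map_le_smul {T : X → X} (hT : Measurable T) {C : ℝ≥0∞}
    (hmap : μ.map T ≤ C • μ) {G : X → E} (hG : AEStronglyMeasurable G μ) :
    AEStronglyMeasurable (G ∘ T) μ :=
  (hG.mono_ac (Measure.absolutelyContinuous_of_le_smul hmap)).comp_measurable hT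

lemma eLpNorm_comp_le_of_map_le_smul {T : X → X} (hT : Measurable T) {C : ℝ≥0∞}
    (hmap : μ.map T ≤ C • μ) {G : X → E} (hG : AEStronglyMeasurable G μ) :
    eLpNorm (G ∘ T) p μ ≤ C ^ (1 / p).toReal * eLpNorm G p μ := by
  rw [← eLpNorm_map_measure (hG.mono_ac (Measure.absolutelyContinuous_of_le_smul hmap))
    hT.aemeasurable]
  exact eLpNorm_le_of_measure_le_smul hmap

variable [TopologicalSpace X] [NormalSpace X] [BorelSpace X] [IsFiniteMeasure μ] [μ.WeaklyRegular]
  [NormedSpace ℝ E]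

lemma tendsto_eLpNorm_comp_sub (hp : p ≠ ∞) {F : X → E} (hF : MemLp F p μ)
    {T : ι → X → X} (hT : ∀ᶠ i in l, Measurable (T i))
    (hlim : ∀ x, Tendsto (fun i => T i x) l (𝓝 x)) {C : ℝ≥0∞} (hC : C ≠ ∞)
    (hmap : ∀ᶠ i in l, μ.map (T i) ≤ C • μ) :
    Tendsto (fun i => eLpNorm (F ∘ T i - F) p μ) l (𝓝 0) := by
  refine ENNReal.tendsto_nhds_zero.2 fun ε hε => ?_
  obtain ⟨η, hη, hηadd⟩ := exists_Lp_half E μ p hε.ne'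
  obtain ⟨δ, hδ, hδadd⟩ := exists_Lp_half E μ p hη.ne'
  set K : ℝ≥0∞ := C ^ (1 / p).toReal
  have hK : K ≠ ∞ := ENNReal.rpow_ne_top_of_nonneg ENNReal.toReal_nonneg hC
  obtain ⟨g, hFg, hg⟩ := hF.exists_boundedContinuous_eLpNorm_sub_le hp
    (ε := min δ (δ / K)) (lt_min hδ (ENNReal.div_pos hδ.ne' hK)).ne'
  have hgT : Tendsto (fun i => eLpNorm (⇑g ∘ T i - ⇑g) p μ) l (𝓝 0) := by
    refine tendsto_eLpNorm_zero_of_dominated hp ?_ (memLp_const (2 * ‖g‖))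
      (Eventually.of_forall fun i => ae_of_all _ fun x => ?_) (ae_of_all _ fun x => ?_)
    · filter_upwards [hT, hmap] with i hTi hi
      exact (aestronglyMeasurable_comp_of_map_le_smul hTi hi hg.1).sub hg.1
    · simpa [two_mul] using norm_sub_le_of_le (g.norm_coe_le_norm (T i x)) (g.norm_coe_le_norm x)
    · simpa using ((g.continuous.tendsto x).comp (hlim x)).sub_const (g x)
  filter_upwards [hT, hmap, ENNReal.tendsto_nhds_zero.1 hgT η hη] with i hTi hi hgi
  have hmeas := fun {G : X → E} => aestronglyMeasurable_comp_of_map_le_smul (G := G) hTi hi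
  have hFgT : eLpNorm ((F - ⇑g) ∘ T i) p μ ≤ δ :=
    calc eLpNorm ((F - ⇑g) ∘ T i) p μ ≤ K * eLpNorm (F - ⇑g) p μ :=
          eLpNorm_comp_le_of_map_le_smul hTi hi (hF.1.sub hg.1)
      _ ≤ K * (δ / K) := by gcongr; exact hFg.trans (min_le_right _ _)
      _ ≤ δ := ENNReal.mul_div_le
  have hgF : eLpNorm (⇑g - F) p μ ≤ δ := by
    rw [eLpNorm_sub_comm]; exact hFg.trans (min_le_left _ _)
  have hsplit : F ∘ T i - F = ((F - ⇑g) ∘ T i + (⇑g - F)) + (⇑g ∘ T i - ⇑g) := by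
    ext x; simp only [Pi.add_apply, Pi.sub_apply, Function.comp_apply]; abel
  rw [hsplit]
  exact (hηadd _ _ ((hmeas (hF.1.sub hg.1)).add (hg.1.sub hF.1)) ((hmeas hg.1).sub hg.1)
    (hδadd _ _ (hmeas (hF.1.sub hg.1)) (hg.1.sub hF.1) hFgT hgF).le hgi).le

end Convergence

section Gaussian

lemma map_withDensity_le_smul {X : Type*} [MeasurableSpace X] {μ : Measure X} {T : X → X}
    (hT : Measurable T) {C : ℝ≥0∞} (hmap : μ.map T ≤ C • μ) {ρ : X → ℝ≥0∞} (hρ : Measurable ρ)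
    (hle : ∀ x, ρ x ≤ ρ (T x)) :
    (μ.withDensity ρ).map T ≤ C • μ.withDensity ρ := by
  refine Measure.le_iff.2 fun s hs => ?_
  rw [Measure.map_apply hT hs, withDensity_apply _ (hT hs), Measure.smul_apply,
    withDensity_apply _ hs]
  calc ∫⁻ x in T ⁻¹' s, ρ x ∂μ ≤ ∫⁻ x in T ⁻¹' s, ρ (T x) ∂μ := by gcongr; exact hle _
    _ = ∫⁻ y in s, ρ y ∂μ.map T := (setLIntegral_map hs hρ hT).symm
    _ ≤ ∫⁻ y in s, ρ y ∂(C • μ) := by gcongr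
    _ = C • ∫⁻ y in s, ρ y ∂μ := by rw [setLIntegral_smul_measure]

lemma integrable_exp_neg_mul_norm_sq {b : ℝ} (hb : 0 < b) :
    Integrable fun z : ℂ => Real.exp (-b * ‖z‖ ^ 2) :=
  Integrable.of_integral_ne_zero <| by
    rw [GaussianFourier.integral_rexp_neg_mul_sq_norm hb]
    positivity

/-- The Gaussian measure `(γ / 2π) e^{-γ|z|²/2} dm(z)` on `ℂ`. With `γ = αp`, the slice norm
`‖f‖_{p,α,I}` is the `L^p` norm of the restriction of `f` to `ℂ_I` for this measure. -/
noncomputable def fockMeasure (γ : ℝ) : Measure ℂ :=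
  volume.withDensity fun z =>
    ENNReal.ofReal (γ / (2 * Real.pi) * Real.exp (-(γ / 2) * ‖z‖ ^ 2))

variable {γ : ℝ}

lemma isFiniteMeasure_fockMeasure (hγ : 0 < γ) : IsFiniteMeasure (fockMeasure γ) :=
  isFiniteMeasure_withDensity_ofReal
    ((integrable_exp_neg_mul_norm_sq (half_pos hγ)).const_mul _).hasFiniteIntegral

lemma map_fockMeasure_le_smul (hγ : 0 ≤ γ) {T : ℂ → ℂ} (hT : Measurable T) {C : ℝ≥0∞}
    (hmap : (volume : Measure ℂ).map T ≤ C • volume) (hle : ∀ z, ‖T z‖ ≤ ‖z‖) :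
    (fockMeasure γ).map T ≤ C • fockMeasure γ := by
  refine map_withDensity_le_smul hT hmap (by fun_prop) fun z => ?_
  gcongr ENNReal.ofReal (_ * Real.exp ?_)
  nlinarith [mul_le_mul_of_nonneg_left (pow_le_pow_left₀ (norm_nonneg _) (hle z) 2) hγ]

lemma map_smul_fockMeasure_le (hγ : 0 ≤ γ) {r : ℝ} (hr₀ : 0 < r) (hr₁ : r ≤ 1) :
    (fockMeasure γ).map (r • ·) ≤ ENNReal.ofReal (r⁻¹ ^ 2) • fockMeasure γ := by
  refine map_fockMeasure_le_smul hγ (measurable_const_smul r) ?_ fun z => ?_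
  · rw [Measure.map_addHaar_smul _ hr₀.ne', Complex.finrank_real_complex, ← inv_pow,
      abs_of_nonneg (by positivity)]
  · rw [norm_smul, Real.norm_of_nonneg hr₀.le]
    exact mul_le_of_le_one_left (norm_nonneg z) hr₁

lemma map_conj_fockMeasure_le (hγ : 0 ≤ γ) :
    (fockMeasure γ).map (starRingEnd ℂ) ≤ (1 : ℝ≥0∞) • fockMeasure γ :=
  map_fockMeasure_le_smul hγ Complex.continuous_conj.measurable
    (by rw [one_smul]; exact Complex.conjLIE.measurePreserving.map_eq.le)
    fun z => (Complex.norm_conj z).le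

lemma memLp_exp_fockMeasure {p β : ℝ} (hp : 0 < p) (hβ : β * p < γ) :
    MemLp (fun z : ℂ => Real.exp (β / 2 * ‖z‖ ^ 2)) (ENNReal.ofReal p) (fockMeasure γ) := by
  rw [← integrable_norm_rpow_iff (by fun_prop) (ENNReal.ofReal_pos.2 hp).ne'
    ENNReal.ofReal_ne_top, fockMeasure, integrable_withDensity_iff (by fun_prop) (by simp)]
  convert! (integrable_exp_neg_mul_norm_sq (half_pos (sub_pos.2 hβ))).const_mul
    (ENNReal.ofReal (γ / (2 * Real.pi))).toReal using 2 with z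
  rw [ENNReal.ofReal_mul' (Real.exp_nonneg _), ENNReal.toReal_mul,
    ENNReal.toReal_ofReal (Real.exp_nonneg _), ENNReal.toReal_ofReal hp.le, Real.norm_of_nonneg
    (Real.exp_nonneg _), ← Real.exp_mul, mul_left_comm, ← Real.exp_add]
  ring_nf

lemma volume_restrict_ball_le_fockMeasure (hγ : 0 < γ) (z : ℂ) (R : ℝ) :
    volume.restrict (Metric.ball z R) ≤
      ENNReal.ofReal (2 * Real.pi / γ * Real.exp (γ / 2 * (‖z‖ + R) ^ 2)) • fockMeasure γ := by
  refine Measure.le_iff.2 fun s hs => ?_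
  rw [fockMeasure, Measure.smul_apply, withDensity_apply _ hs, smul_eq_mul,
    ← lintegral_const_mul _ (by fun_prop), Measure.restrict_apply hs, ← setLIntegral_one]
  refine (setLIntegral_mono (by fun_prop) fun w hw => ?_).trans
    (lintegral_mono_set Set.inter_subset_left)
  rw [← ENNReal.ofReal_mul (by positivity), ENNReal.one_le_ofReal]
  have hw' : ‖w‖ ≤ ‖z‖ + R := by
    linarith [norm_sub_norm_le w z, mem_ball_iff_norm.1 hw.2]
  calc 1 ≤ Real.exp (γ / 2 * ((‖z‖ + R) ^ 2 - ‖w‖ ^ 2)) :=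
        Real.one_le_exp (mul_nonneg (half_pos hγ).le
          (sub_nonneg.2 (pow_le_pow_left₀ (norm_nonneg w) hw' 2)))
    _ = _ := by
        rw [mul_sub, sub_eq_add_neg, Real.exp_add]
        field_simp

end Gaussian

section Entire

variable {E : Type*} [NormedAddCommGroup E] [NormedSpace ℂ E] {F : ℂ → E} {p α : ℝ}

lemma exists_norm_le_mul_exp_add_one_sq (hp : 0 < p) (hα : 0 < α) (hF : Differentiable ℂ F)
    (hFp : MemLp F (ENNReal.ofReal p) (fockMeasure (α * p))) :
    ∃ C, 0 ≤ C ∧ ∀ z, ‖F z‖ ≤ C * Real.exp (α / 2 * (‖z‖ + 1) ^ 2) := by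
  obtain ⟨C₀, hC₀, hsub⟩ := exists_ofReal_rpow_mul_norm_le_mul_eLpNorm_ball (E := E) hp
  set A : ℝ := 2 * Real.pi / (α * p)
  set M : ℝ≥0∞ := C₀ * ENNReal.ofReal (A ^ (1 / p)) *
    eLpNorm F (ENNReal.ofReal p) (fockMeasure (α * p))
  have hM : M ≠ ∞ := by have := hFp.2.ne; finiteness
  have hroot : ∀ x : ℝ, (A * Real.exp (α * p / 2 * x)) ^ (1 / p) =
      A ^ (1 / p) * Real.exp (α / 2 * x) := fun x => by
    rw [Real.mul_rpow (by positivity) (Real.exp_nonneg _), ← Real.exp_mul]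
    congr 2
    field_simp
  refine ⟨M.toReal, ENNReal.toReal_nonneg, fun z => ?_⟩
  set x := (‖z‖ + 1) ^ 2
  have hz : ENNReal.ofReal ‖F z‖ ≤ M * ENNReal.ofReal (Real.exp (α / 2 * x)) :=
    calc ENNReal.ofReal ‖F z‖
        ≤ C₀ * eLpNorm F (ENNReal.ofReal p) (volume.restrict (Metric.ball z 1)) := by
          simpa using hsub F z 1 one_pos hF.diffContOnCl
      _ ≤ C₀ * (ENNReal.ofReal (A * Real.exp (α * p / 2 * x)) ^ (1 / p) *
            eLpNorm F (ENNReal.ofReal p) (fockMeasure (α * p))) := by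
          gcongr
          simpa [hp.le] using eLpNorm_le_of_measure_le_smul (f := F) (p := ENNReal.ofReal p)
            (volume_restrict_ball_le_fockMeasure (mul_pos hα hp) z 1)
      _ = M * ENNReal.ofReal (Real.exp (α / 2 * x)) := by
          rw [ENNReal.ofReal_rpow_of_nonneg (by positivity) (by positivity), hroot,
            ENNReal.ofReal_mul (by positivity)]
          ring
  rwa [ENNReal.ofReal_le_iff_le_toReal (by finiteness), ENNReal.toReal_mul,
    ENNReal.toReal_ofReal (Real.exp_nonneg _)] at hz

lemma half_mul_add_one_sq_le {β : ℝ} (hβ : α < β) (x : ℝ) :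
    α / 2 * (x + 1) ^ 2 ≤ α * β / (2 * (β - α)) + β / 2 * x ^ 2 := by
  have hβα : 0 < β - α := sub_pos.2 hβ
  have hsq : α * β / (2 * (β - α)) + β / 2 * x ^ 2 - α / 2 * (x + 1) ^ 2 =
      ((β - α) * x - α) ^ 2 / (2 * (β - α)) := by
    field_simp
    ring
  rw [← sub_nonneg, hsq]
  positivity

lemma exists_norm_le_mul_exp_sq (hp : 0 < p) (hα : 0 < α) (hF : Differentiable ℂ F)
    (hFp : MemLp F (ENNReal.ofReal p) (fockMeasure (α * p))) {β : ℝ} (hβ : α < β) :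
    ∃ C, ∀ z, ‖F z‖ ≤ C * Real.exp (β / 2 * ‖z‖ ^ 2) := by
  obtain ⟨C, hC₀, hC⟩ := exists_norm_le_mul_exp_add_one_sq hp hα hF hFp
  refine ⟨C * Real.exp (α * β / (2 * (β - α))), fun z => (hC z).trans ?_⟩
  rw [mul_assoc, ← Real.exp_add]
  gcongr
  exact half_mul_add_one_sq_le hβ _

lemma tendsto_eLpNorm_dilation_sub (hp : 0 < p) (hα : 0 < α)
    (hF : MemLp F (ENNReal.ofReal p) (fockMeasure (α * p))) :
    Tendsto (fun r : ℝ => eLpNorm (fun z => F (r • z) - F z) (ENNReal.ofReal p)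
      (fockMeasure (α * p))) (𝓝[<] 1) (𝓝 0) := by
  have := isFiniteMeasure_fockMeasure (mul_pos hα hp)
  have hlim (z : ℂ) : Tendsto (fun r : ℝ => r • z) (𝓝[<] 1) (𝓝 z) := by
    have h : Tendsto (fun r : ℝ => r • z) (𝓝 1) (𝓝 ((1 : ℝ) • z)) :=
      Continuous.tendsto (by fun_prop) 1
    rw [one_smul] at h
    exact h.mono_left nhdsWithin_le_nhds
  refine tendsto_eLpNorm_comp_sub ENNReal.ofReal_ne_top hF
    (Eventually.of_forall measurable_const_smul) hlim (ENNReal.ofNat_ne_top (n := 4)) ?_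
  filter_upwards [Ioo_mem_nhdsLT (show (1 / 2 : ℝ) < 1 by norm_num)] with r hr
  have hr₀ : 0 < r := by linarith [hr.1]
  have hinv : r⁻¹ ≤ 2 := inv_le_of_inv_le₀ two_pos (by linarith [hr.1])
  refine (map_smul_fockMeasure_le (mul_pos hα hp).le hr₀ hr.2.le).trans ?_
  gcongr
  rw [ENNReal.ofReal_le_ofNat]
  nlinarith [inv_pos.2 hr₀]

/-- The `k`-th coefficient `F⁽ᵏ⁾(0) / k!` of the power series of an entire function at `0`. -/
noncomputable def taylorCoeff (F : ℂ → E) (k : ℕ) : E :=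
  (k.factorial : ℂ)⁻¹ • iteratedDeriv k F 0

variable [CompleteSpace E]

lemma hasSum_pow_smul_taylorCoeff (hF : Differentiable ℂ F) (z : ℂ) :
    HasSum (fun k => z ^ k • taylorCoeff F k) (F z) := by
  simpa only [taylorCoeff, sub_zero, smul_comm (z ^ _)] using
    Complex.hasSum_taylorSeries_of_entire hF 0 z

lemma norm_taylorCoeff_mul_pow_le (hF : Differentiable ℂ F) {R M : ℝ} (hR : 0 ≤ R)
    (hM : ∀ z, ‖z‖ = R → ‖F z‖ ≤ M) (k : ℕ) : ‖taylorCoeff F k‖ * R ^ k ≤ M := by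
  rcases hR.eq_or_lt with rfl | hR
  · have h0 : ‖F 0‖ ≤ M := hM 0 norm_zero
    rcases k with _ | k
    · simpa [taylorCoeff] using h0
    · simpa using (norm_nonneg _).trans h0
  have hcauchy := Complex.norm_iteratedDeriv_le_of_forall_mem_sphere_norm_le k hR
    hF.diffContOnCl (c := 0) fun z hz => hM z (by simpa using hz)
  rw [le_div_iff₀ (by positivity)] at hcauchy
  rwa [taylorCoeff, norm_smul, norm_inv, Complex.norm_natCast, mul_assoc,
    inv_mul_le_iff₀ (by positivity)]

lemma norm_sum_taylorCoeff_sub_le (hF : Differentiable ℂ F) {R M s : ℝ} (hR : 0 ≤ R)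
    (hM : ∀ z, ‖z‖ = R → ‖F z‖ ≤ M) (hs₀ : 0 ≤ s) (hs₁ : s < 1) {z : ℂ}
    (hz : ‖z‖ ≤ R * s) (N : ℕ) :
    ‖∑ k ∈ Finset.range N, z ^ k • taylorCoeff F k - F z‖ ≤ M * s ^ N / (1 - s) := by
  refine norm_sub_le_of_geometric_bound_of_hasSum hs₁ (fun k => ?_)
    (hasSum_pow_smul_taylorCoeff hF z) N
  calc ‖z ^ k • taylorCoeff F k‖ ≤ (R * s) ^ k * ‖taylorCoeff F k‖ := by
        rw [norm_smul, norm_pow]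
        gcongr
    _ = ‖taylorCoeff F k‖ * R ^ k * s ^ k := by ring
    _ ≤ M * s ^ k := by
        gcongr
        exact norm_taylorCoeff_mul_pow_le hF hR hM k

lemma tendsto_eLpNorm_taylor_dilation (hp : 0 < p) (hα : 0 < α) (hF : Differentiable ℂ F)
    (hFp : MemLp F (ENNReal.ofReal p) (fockMeasure (α * p))) {r : ℝ} (hr₀ : 0 < r) (hr₁ : r < 1) :
    Tendsto (fun N => eLpNorm
        (fun z => ∑ k ∈ Finset.range N, (r • z) ^ k • taylorCoeff F k - F (r • z))
        (ENNReal.ofReal p) (fockMeasure (α * p))) atTop (𝓝 0) := by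
  set s := √r
  have hs₀ : 0 < s := Real.sqrt_pos.2 hr₀
  have hs₁ : s < 1 := by rwa [Real.sqrt_lt' one_pos, one_pow]
  have hs : s * s = r := Real.mul_self_sqrt hr₀.le
  obtain ⟨C, hC⟩ := exists_norm_le_mul_exp_sq hp hα hF hFp
    ((lt_div_iff₀ hs₀).2 (mul_lt_of_lt_one_right hα hs₁))
  have hbound : ∀ N z, ‖∑ k ∈ Finset.range N, (r • z) ^ k • taylorCoeff F k - F (r • z)‖ ≤
      C / (1 - s) * s ^ N * ‖Real.exp (α * s / 2 * ‖z‖ ^ 2)‖ := fun N z => by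
    refine (norm_sum_taylorCoeff_sub_le hF (R := ‖z‖ * s)
      (M := C * Real.exp (α * s / 2 * ‖z‖ ^ 2)) (by positivity) (fun w hw => ?_)
      hs₀.le hs₁ ?_ N).trans_eq ?_
    · convert hC w using 3
      rw [hw]; field_simp
    · rw [norm_smul, Real.norm_of_nonneg hr₀.le, ← hs, mul_comm, mul_assoc ‖z‖]
    · rw [Real.norm_of_nonneg (Real.exp_nonneg _)]; ring
  have hβ : α * s * p < α * p := mul_lt_mul_of_pos_right (mul_lt_of_lt_one_right hα hs₁) hp
  have hexp := memLp_exp_fockMeasure hp hβ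
  refine tendsto_of_tendsto_of_tendsto_of_le_of_le tendsto_const_nhds ?_ (fun _ => zero_le)
    fun N => eLpNorm_le_mul_eLpNorm_of_ae_le_mul (ae_of_all _ (hbound N)) _
  have hgeom : Tendsto (fun N => ENNReal.ofReal (C / (1 - s) * s ^ N)) atTop (𝓝 0) := by
    simpa using ENNReal.tendsto_ofReal
      ((tendsto_pow_atTop_nhds_zero_of_lt_one hs₀.le hs₁).const_mul (C / (1 - s)))
  simpa using ENNReal.Tendsto.mul_const hgeom (Or.inr hexp.2.ne)

lemma exists_eLpNorm_taylor_sub_le (hp : 0 < p) (hα : 0 < α) (hF : Differentiable ℂ F)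
    (hFp : MemLp F (ENNReal.ofReal p) (fockMeasure (α * p))) {ε : ℝ≥0∞} (hε : ε ≠ 0) :
    ∃ (r : ℝ) (N : ℕ),
      eLpNorm (fun z => ∑ k ∈ Finset.range N, (r • z) ^ k • taylorCoeff F k - F z)
        (ENNReal.ofReal p) (fockMeasure (α * p)) ≤ ε := by
  obtain ⟨δ, hδ, hadd⟩ := exists_Lp_half E (fockMeasure (α * p)) (ENNReal.ofReal p) hε
  obtain ⟨r, hdil, hr⟩ := ((ENNReal.tendsto_nhds_zero.1
    (tendsto_eLpNorm_dilation_sub hp hα hFp) δ hδ).and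
    (Ioo_mem_nhdsLT zero_lt_one)).exists
  obtain ⟨N, hN⟩ := (ENNReal.tendsto_nhds_zero.1
    (tendsto_eLpNorm_taylor_dilation hp hα hF hFp hr.1 hr.2) δ hδ).exists
  have hcont := hF.continuous
  refine ⟨r, N, le_of_eq_of_le (congrArg (eLpNorm · _ _) (funext fun z => ?_))
    (hadd _ _ (Continuous.aestronglyMeasurable (by fun_prop))
      (Continuous.aestronglyMeasurable (by fun_prop)) hN hdil).le⟩
  exact (sub_add_sub_cancel _ _ _).symm

end Entire

section Slice

lemma slicePt_eq_smul_add_smul (I : ℍ[ℝ]) (z : ℂ) : slicePt I z = z.re • 1 + z.im • I := by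
  rw [slicePt, ← Quaternion.coe_commutes, Quaternion.coe_mul_eq_smul,
    ← Quaternion.coe_mul_eq_smul z.re, mul_one]

lemma slicePt_ofReal (I : ℍ[ℝ]) (x : ℝ) : slicePt I x = x := by
  simp [slicePt]

/-- `slicePt I` as a continuous real-linear map. -/
noncomputable def slicePtCLM (I : ℍ[ℝ]) : ℂ →L[ℝ] ℍ[ℝ] :=
  Complex.reCLM.smulRight 1 + Complex.imCLM.smulRight I

lemma coe_slicePtCLM (I : ℍ[ℝ]) : ⇑(slicePtCLM I) = slicePt I :=
  funext fun z => (slicePt_eq_smul_add_smul I z).symm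

lemma continuous_slicePt (I : ℍ[ℝ]) : Continuous (slicePt I) :=
  coe_slicePtCLM I ▸ (slicePtCLM I).continuous

lemma slicePt_smul (I : ℍ[ℝ]) (r : ℝ) (z : ℂ) : slicePt I (r • z) = r • slicePt I z := by
  simpa only [coe_slicePtCLM] using (slicePtCLM I).map_smul r z

lemma exists_slicePt_eq (q : ℍ[ℝ]) : ∃ I ∈ imagUnits, ∃ z : ℂ, slicePt I z = q := by
  by_cases h : q.im = 0
  · refine ⟨(Complex.I : ℂ), by simp [imagUnits], (q.re : ℂ), ?_⟩
    rw [slicePt_ofReal]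
    conv_rhs => rw [← Quaternion.re_add_im q, h, add_zero]
  · have hnorm : ‖q.im‖ ≠ 0 := norm_ne_zero_iff.2 h
    have hsq : q.imI ^ 2 + q.imJ ^ 2 + q.imK ^ 2 = ‖q.im‖ ^ 2 := by
      rw [sq ‖q.im‖, ← Quaternion.normSq_eq_norm_mul_self, Quaternion.normSq_def']
      simp
    refine ⟨‖q.im‖⁻¹ • q.im, ⟨by simp, ?_⟩, ⟨q.re, ‖q.im‖⟩, ?_⟩
    · simp only [Quaternion.imI_smul, Quaternion.imJ_smul, Quaternion.imK_smul, Quaternion.imI_im,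
        Quaternion.imJ_im, Quaternion.imK_im, smul_eq_mul, mul_pow]
      rw [← mul_add, ← mul_add, hsq, ← mul_pow, inv_mul_cancel₀ hnorm, one_pow]
    · rw [slicePt, ← Quaternion.coe_commutes, Quaternion.coe_mul_eq_smul, smul_smul,
        mul_inv_cancel₀ hnorm, one_smul, Quaternion.re_add_im]

variable {I : ℍ[ℝ]}

lemma mul_self_of_mem_imagUnits (hI : I ∈ imagUnits) : I * I = -1 := by
  obtain ⟨hre, him⟩ := hI
  ext <;> simp [hre] <;> linarith

lemma norm_of_mem_imagUnits (hI : I ∈ imagUnits) : ‖I‖ = 1 := by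
  have h := congrArg norm (mul_self_of_mem_imagUnits hI)
  rw [norm_mul, norm_neg, norm_one] at h
  nlinarith [norm_nonneg I]

lemma norm_slicePt (hI : I ∈ imagUnits) (z : ℂ) : ‖slicePt I z‖ = ‖z‖ := by
  obtain ⟨hre, him⟩ := hI
  have h : Quaternion.normSq (slicePt I z) = Complex.normSq z := by
    have hre' : (slicePt I z).re = z.re := by simp [slicePt, hre]
    have hi : (slicePt I z).imI = I.imI * z.im := by simp [slicePt]
    have hj : (slicePt I z).imJ = I.imJ * z.im := by simp [slicePt]
    have hk : (slicePt I z).imK = I.imK * z.im := by simp [slicePt]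
    rw [Quaternion.normSq_def', Complex.normSq_apply, hre', hi, hj, hk]
    linear_combination z.im ^ 2 * him
  rw [Quaternion.normSq_eq_norm_mul_self, Complex.normSq_eq_norm_sq, sq] at h
  exact (mul_self_inj_of_nonneg (norm_nonneg _) (norm_nonneg _)).1 h

lemma slicePt_eq_liftAux (hI : I ∈ imagUnits) (z : ℂ) :
    slicePt I z = Complex.liftAux I (mul_self_of_mem_imagUnits hI) z := by
  rw [Complex.liftAux_apply, slicePt_eq_smul_add_smul, Algebra.algebraMap_eq_smul_one]

lemma slicePt_pow (hI : I ∈ imagUnits) (z : ℂ) (k : ℕ) : slicePt I (z ^ k) = slicePt I z ^ k := by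
  simp only [slicePt_eq_liftAux hI, map_pow]

/-- The complex structure on `ℍ` given by left multiplication with elements of `ℂ_I`. -/
noncomputable abbrev sliceNormedSpace (hI : I ∈ imagUnits) : NormedSpace ℂ ℍ[ℝ] :=
  { Module.compHom ℍ[ℝ] (Complex.liftAux I (mul_self_of_mem_imagUnits hI)).toRingHom with
    norm_smul_le := fun z q => by
      change ‖Complex.liftAux I (mul_self_of_mem_imagUnits hI) z * q‖ ≤ _
      rw [← slicePt_eq_liftAux hI, norm_mul, norm_slicePt hI] }

lemma sliceNormedSpace_smul (hI : I ∈ imagUnits) (z : ℂ) (q : ℍ[ℝ]) :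
    letI := sliceNormedSpace hI
    z • q = slicePt I z * q := by
  rw [slicePt_eq_liftAux hI]; rfl

end Slice

lemma coeff_eq_of_eventually_hasSum {𝕜 V : Type*} [NontriviallyNormedField 𝕜]
    [NormedAddCommGroup V] [NormedSpace 𝕜 V] {a b : ℕ → V} {g : 𝕜 → V}
    (ha : ∀ᶠ x in 𝓝 0, HasSum (fun k => x ^ k • a k) (g x))
    (hb : ∀ᶠ x in 𝓝 0, HasSum (fun k => x ^ k • b k) (g x)) : a = b := by
  have hseries : ∀ c : ℕ → V, (∀ᶠ x in 𝓝 0, HasSum (fun k => x ^ k • c k) (g x)) →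
      HasFPowerSeriesAt g (fun n => ContinuousMultilinearMap.mkPiRing 𝕜 (Fin n) (c n)) 0 :=
    fun c hc => hasFPowerSeriesAt_iff.2 <| by
      simpa [FormalMultilinearSeries.coeff] using hc
  have h := (hseries a ha).eq_formalMultilinearSeries (hseries b hb)
  funext n
  simpa [FormalMultilinearSeries.coeff] using congrArg (FormalMultilinearSeries.coeff · n) h

section Regular

variable {f : ℍ[ℝ] → ℍ[ℝ]} {I : ℍ[ℝ]}

lemma IsEntireSliceRegular.fderiv_apply_imagUnit (hf : IsEntireSliceRegular f)
    (hI : I ∈ imagUnits) (z : ℂ) :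
    fderiv ℝ f (slicePt I z) I = I * fderiv ℝ f (slicePt I z) 1 := by
  set L := fderiv ℝ f (slicePt I z)
  have hL : HasFDerivAt f L (slicePt I z) := (hf.differentiable _).hasFDerivAt
  have hx : HasDerivAt (fun s : ℝ => f (slicePt I ⟨s, z.im⟩)) (L 1) z.re := by
    refine hL.comp_hasDerivAt (f := fun s : ℝ => slicePt I ⟨s, z.im⟩) z.re ?_
    simpa [slicePt_eq_smul_add_smul] using
      ((hasDerivAt_id z.re).smul_const (1 : ℍ[ℝ])).add_const (z.im • I)
  have hy : HasDerivAt (fun t : ℝ => f (slicePt I ⟨z.re, t⟩)) (L I) z.im := by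
    refine hL.comp_hasDerivAt (f := fun t : ℝ => slicePt I ⟨z.re, t⟩) z.im ?_
    simpa [slicePt_eq_smul_add_smul] using
      ((hasDerivAt_id z.im).smul_const I).const_add (z.re • (1 : ℍ[ℝ]))
  have hdbar : L 1 + I * L I = 0 := by
    have h := hf.dbar_eq_zero I hI z.re z.im
    rw [sliceDbar, hx.deriv, hy.deriv] at h
    exact (smul_eq_zero.1 h).resolve_left (by norm_num)
  rw [eq_neg_of_add_eq_zero_left hdbar, mul_neg, ← mul_assoc, mul_self_of_mem_imagUnits hI,
    neg_one_mul, neg_neg]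

lemma IsEntireSliceRegular.differentiable_slice (hf : IsEntireSliceRegular f)
    (hI : I ∈ imagUnits) :
    letI := sliceNormedSpace hI
    Differentiable ℂ fun z => f (slicePt I z) := by
  intro z
  set L := fderiv ℝ f (slicePt I z)
  have hd : HasFDerivAt (fun z => f (slicePt I z)) (L.comp (slicePtCLM I)) z := by
    rw [← coe_slicePtCLM]
    exact HasFDerivAt.comp z (coe_slicePtCLM I ▸ (hf.differentiable _).hasFDerivAt)
      (slicePtCLM I).hasFDerivAt
  have hlin : ∀ w, L.comp (slicePtCLM I) w = slicePt I w * L 1 := fun w => by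
    rw [ContinuousLinearMap.comp_apply, coe_slicePtCLM, slicePt_eq_smul_add_smul, map_add,
      map_smul, map_smul, hf.fderiv_apply_imagUnit hI, add_mul, smul_mul_assoc, smul_mul_assoc,
      one_mul]
  let := sliceNormedSpace hI
  refine HasDerivAt.differentiableAt (f' := L 1) ?_
  rw [hasDerivAt_iff_isLittleO]
  refine (hasFDerivAt_iff_isLittleO.1 hd).congr_left fun w => ?_
  rw [hlin, ← sliceNormedSpace_smul hI]

lemma IsEntireSliceRegular.hasSum_slice (hf : IsEntireSliceRegular f) (hI : I ∈ imagUnits)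
    (z : ℂ) :
    letI := sliceNormedSpace hI
    HasSum (fun k => slicePt I z ^ k * taylorCoeff (fun w => f (slicePt I w)) k)
      (f (slicePt I z)) := by
  let := sliceNormedSpace hI
  simpa only [sliceNormedSpace_smul hI, slicePt_pow hI] using
    hasSum_pow_smul_taylorCoeff (hf.differentiable_slice hI) z

lemma IsEntireSliceRegular.exists_hasSum (hf : IsEntireSliceRegular f) :
    ∃ a : ℕ → ℍ[ℝ], ∀ q, HasSum (fun k => q ^ k * a k) (f q) := by
  have hslice : ∀ I ∈ imagUnits, ∃ a : ℕ → ℍ[ℝ],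
      ∀ z, HasSum (fun k => slicePt I z ^ k * a k) (f (slicePt I z)) :=
    fun I hI => ⟨_, hf.hasSum_slice hI⟩
  choose! a ha using hslice
  have hreal : ∀ I ∈ imagUnits, ∀ x : ℝ, HasSum (fun k => x ^ k • a I k) (f x) :=
    fun I hI x => by
      simpa only [slicePt_ofReal, ← Quaternion.coe_pow, Quaternion.coe_mul_eq_smul] using ha I hI x
  obtain ⟨I, hI, -⟩ := exists_slicePt_eq 0
  refine ⟨a I, fun q => ?_⟩
  obtain ⟨J, hJ, z, rfl⟩ := exists_slicePt_eq q
  rw [coeff_eq_of_eventually_hasSum (.of_forall (hreal I hI)) (.of_forall (hreal J hJ))]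
  exact ha J hJ z

end Regular

section Representation

variable {I J : ℍ[ℝ]}

lemma slicePt_eq_add_slicePt_conj (hI : I ∈ imagUnits) (J : ℍ[ℝ]) (z : ℂ) :
    slicePt J z = (1 / 2 : ℝ) • (1 - J * I) * slicePt I z +
      (1 / 2 : ℝ) • (1 + J * I) * slicePt I (starRingEnd ℂ z) := by
  have h : J * I * (I * (z.im : ℍ[ℝ])) = -(J * z.im) := by
    rw [mul_assoc, ← mul_assoc I, mul_self_of_mem_imagUnits hI]
    simp
  simp only [slicePt, Complex.conj_re, Complex.conj_im, Quaternion.coe_neg, mul_neg,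
    smul_mul_assoc, ← smul_add, add_mul, sub_mul, mul_add, one_mul, h]
  module

lemma apply_slicePt_eq_add_of_hasSum {g : ℍ[ℝ] → ℍ[ℝ]} {c : ℕ → ℍ[ℝ]}
    (hg : ∀ q, HasSum (fun k => q ^ k * c k) (g q)) (hI : I ∈ imagUnits) (hJ : J ∈ imagUnits)
    (z : ℂ) :
    g (slicePt J z) = (1 / 2 : ℝ) • (1 - J * I) * g (slicePt I z) +
      (1 / 2 : ℝ) • (1 + J * I) * g (slicePt I (starRingEnd ℂ z)) := by
  refine (hg (slicePt J z)).unique (HasSum.congr_fun (((hg (slicePt I z)).mul_left _).add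
    ((hg (slicePt I (starRingEnd ℂ z))).mul_left _)) fun k => ?_)
  rw [← slicePt_pow hI, ← slicePt_pow hI, ← slicePt_pow hJ, slicePt_eq_add_slicePt_conj hI,
    map_pow, add_mul, mul_assoc, mul_assoc]

lemma norm_apply_slicePt_le_of_hasSum {g : ℍ[ℝ] → ℍ[ℝ]} {c : ℕ → ℍ[ℝ]}
    (hg : ∀ q, HasSum (fun k => q ^ k * c k) (g q)) (hI : I ∈ imagUnits) (hJ : J ∈ imagUnits)
    (z : ℂ) :
    ‖g (slicePt J z)‖ ≤ ‖g (slicePt I z)‖ + ‖g (slicePt I (starRingEnd ℂ z))‖ := by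
  have hJI : ‖J * I‖ = 1 := by
    rw [norm_mul, norm_of_mem_imagUnits hI, norm_of_mem_imagUnits hJ, one_mul]
  have hsub : ‖(1 / 2 : ℝ) • (1 - J * I)‖ ≤ 1 := by
    rw [norm_smul, Real.norm_of_nonneg (by norm_num)]
    linarith [norm_sub_le 1 (J * I), norm_one (α := ℍ[ℝ])]
  have hadd : ‖(1 / 2 : ℝ) • (1 + J * I)‖ ≤ 1 := by
    rw [norm_smul, Real.norm_of_nonneg (by norm_num)]
    linarith [norm_add_le 1 (J * I), norm_one (α := ℍ[ℝ])]
  rw [apply_slicePt_eq_add_of_hasSum hg hI hJ]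
  refine norm_add_le_of_le ?_ ?_ <;> rw [norm_mul]
  · exact mul_le_of_le_one_left (norm_nonneg _) hsub
  · exact mul_le_of_le_one_left (norm_nonneg _) hadd

end Representation

section SliceNorm

variable {p α : ℝ} {I J : ℍ[ℝ]}

lemma sliceNorm_eq_eLpNorm (hp : 0 < p) (α : ℝ) (hI : I ∈ imagUnits) (g : ℍ[ℝ] → ℍ[ℝ]) :
    sliceNorm p α I g =
      eLpNorm (fun z => g (slicePt I z)) (ENNReal.ofReal p) (fockMeasure (α * p)) := by
  rw [eLpNorm_eq_lintegral_rpow_enorm_toReal (ENNReal.ofReal_pos.2 hp).ne' ENNReal.ofReal_ne_top,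
    ENNReal.toReal_ofReal hp.le, fockMeasure, lintegral_withDensity_eq_lintegral_mul_non_measurable
    _ (by fun_prop) (ae_of_all _ fun _ => ENNReal.ofReal_lt_top), sliceNorm,
    ← lintegral_const_mul' _ _ ENNReal.ofReal_ne_top]
  congr 2 with z
  have hexp : Real.exp (-α * ‖z‖ ^ 2 / 2) ^ p = Real.exp (-(α * p / 2) * ‖z‖ ^ 2) := by
    rw [← Real.exp_mul]
    ring_nf
  rw [norm_slicePt hI, hexp, Pi.mul_apply, ENNReal.ofReal_mul' (Real.exp_nonneg _),
    ENNReal.ofReal_mul' (Real.exp_nonneg _), ← ENNReal.ofReal_rpow_of_nonneg (norm_nonneg _) hp.le,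
    ofReal_norm]
  ring

lemma sliceNorm_le_two_mul_of_hasSum (hp : 0 < p) (hα : 0 ≤ α) {g : ℍ[ℝ] → ℍ[ℝ]}
    (hcont : Continuous g) {c : ℕ → ℍ[ℝ]} (hg : ∀ q, HasSum (fun k => q ^ k * c k) (g q))
    (hI : I ∈ imagUnits) (hJ : J ∈ imagUnits) :
    sliceNorm p α J g ≤ ENNReal.LpAddConst (ENNReal.ofReal p) * (2 * sliceNorm p α I g) := by
  set G : ℂ → ℍ[ℝ] := fun z => g (slicePt I z)
  have hG : Continuous G := hcont.comp (continuous_slicePt I)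
  have hγ : 0 ≤ α * p := by positivity
  rw [sliceNorm_eq_eLpNorm hp α hI, sliceNorm_eq_eLpNorm hp α hJ]
  calc eLpNorm (fun z => g (slicePt J z)) (ENNReal.ofReal p) (fockMeasure (α * p))
      ≤ eLpNorm ((‖G ·‖) + (‖(G ∘ starRingEnd ℂ) ·‖)) (ENNReal.ofReal p) (fockMeasure (α * p)) :=
        eLpNorm_mono_real (norm_apply_slicePt_le_of_hasSum hg hI hJ)
    _ ≤ ENNReal.LpAddConst (ENNReal.ofReal p) *
          (eLpNorm G (ENNReal.ofReal p) (fockMeasure (α * p)) +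
            eLpNorm (G ∘ starRingEnd ℂ) (ENNReal.ofReal p) (fockMeasure (α * p))) := by
        rw [← eLpNorm_norm G, ← eLpNorm_norm (G ∘ starRingEnd ℂ)]
        exact eLpNorm_add_le' hG.norm.aestronglyMeasurable
          (hG.comp Complex.continuous_conj).norm.aestronglyMeasurable _
    _ ≤ _ := by
        rw [two_mul]
        gcongr
        simpa using eLpNorm_comp_le_of_map_le_smul Complex.continuous_conj.measurable
          (map_conj_fockMeasure_le hγ) (p := ENNReal.ofReal p) hG.aestronglyMeasurable

end SliceNorm

section Approximation

lemma hasSum_rightEval (P : Polynomial ℍ[ℝ]) (q : ℍ[ℝ]) :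
    HasSum (fun k => q ^ k * P.coeff k) (rightEval P q) :=
  hasSum_sum_of_ne_finset_zero fun k hk => by
    rw [Polynomial.notMem_support_iff.1 hk, mul_zero]

lemma continuous_rightEval (P : Polynomial ℍ[ℝ]) : Continuous (rightEval P) := by
  unfold rightEval Polynomial.sum
  fun_prop

lemma rightEval_sum_monomial (s : Finset ℕ) (b : ℕ → ℍ[ℝ]) (q : ℍ[ℝ]) :
    rightEval (∑ k ∈ s, Polynomial.monomial k (b k)) q = ∑ k ∈ s, q ^ k * b k := by
  have hcoeff (k : ℕ) :
      (∑ j ∈ s, Polynomial.monomial j (b j)).coeff k = if k ∈ s then b k else 0 := by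
    simp [Polynomial.coeff_monomial]
  refine (hasSum_rightEval _ q).unique ?_
  simp only [hcoeff, mul_ite, mul_zero]
  rw [← Finset.sum_congr rfl fun k hk => if_pos hk]
  exact hasSum_sum_of_ne_finset_zero fun k hk => if_neg hk

lemma IsEntireSliceRegular.exists_sliceNorm_rightEval_sub_le {f : ℍ[ℝ] → ℍ[ℝ]} {I : ℍ[ℝ]}
    {p α : ℝ} (hf : IsEntireSliceRegular f) (hp : 0 < p) (hα : 0 < α) (hI : I ∈ imagUnits)
    (hnorm : sliceNorm p α I f < ∞) {ε : ℝ≥0∞} (hε : ε ≠ 0) :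
    ∃ P : Polynomial ℍ[ℝ], sliceNorm p α I (fun q => rightEval P q - f q) ≤ ε := by
  let := sliceNormedSpace hI
  have hcont : Continuous fun z => f (slicePt I z) :=
    hf.differentiable.continuous.comp (continuous_slicePt I)
  rw [sliceNorm_eq_eLpNorm hp α hI] at hnorm
  obtain ⟨r, N, h⟩ := exists_eLpNorm_taylor_sub_le hp hα (hf.differentiable_slice hI)
    ⟨hcont.aestronglyMeasurable, hnorm⟩ hε
  refine ⟨∑ k ∈ Finset.range N,
    Polynomial.monomial k (r ^ k • taylorCoeff (fun z => f (slicePt I z)) k), ?_⟩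
  rw [sliceNorm_eq_eLpNorm hp α hI]
  refine le_of_eq_of_le ?_ h
  simp only [rightEval_sum_monomial, sliceNormedSpace_smul hI, slicePt_pow hI, slicePt_smul,
    smul_pow, mul_smul_comm, smul_mul_assoc]

end Approximation

end SliceFock

theorem theorem4p4 (p α : ℝ) (hp : 0 < p) (hα : 0 < α)
    (f : ℍ[ℝ] → ℍ[ℝ]) (hf : f ∈ SliceFock.fockSecondKind α p) :
    ∃ P : ℕ → Polynomial ℍ[ℝ], ∀ I ∈ SliceFock.imagUnits,
      Tendsto (fun n => SliceFock.sliceNorm p α I (fun q => SliceFock.rightEval (P n) q - f q))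
        atTop (𝓝 0) := by
  open SliceFock in
  obtain ⟨hreg, I, hI, -, hnorm⟩ := hf
  obtain ⟨a, ha⟩ := hreg.exists_hasSum
  choose P hP using fun n : ℕ =>
    hreg.exists_sliceNorm_rightEval_sub_le hp hα hI hnorm (ε := (n : ℝ≥0∞)⁻¹) (by simp)
  refine ⟨P, fun J hJ => ?_⟩
  set K := ENNReal.LpAddConst (ENNReal.ofReal p)
  have hbound : ∀ n, sliceNorm p α J (fun q => rightEval (P n) q - f q) ≤
      K * (2 * (n : ℝ≥0∞)⁻¹) := fun n => by
    have hseries : ∀ q, HasSum (fun k => q ^ k * ((P n).coeff k - a k))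
        (rightEval (P n) q - f q) := fun q => by
      simpa only [mul_sub] using (hasSum_rightEval (P n) q).sub (ha q)
    exact (sliceNorm_le_two_mul_of_hasSum hp hα.le ((continuous_rightEval (P n)).sub
      hreg.differentiable.continuous) hseries hI hJ).trans (by gcongr; exact hP n)
  have hlim : Tendsto (fun n : ℕ => K * (2 * (n : ℝ≥0∞)⁻¹)) atTop (𝓝 0) := by
    simpa using ENNReal.Tendsto.const_mul (ENNReal.Tendsto.const_mul
      ENNReal.tendsto_inv_nat_nhds_zero (Or.inr ENNReal.ofNat_ne_top))
      (Or.inr (ENNReal.LpAddConst_lt_top _).ne)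
  exact tendsto_of_tendsto_of_tendsto_of_le_of_le tendsto_const_nhds hlim (fun _ => zero_le) hbound
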